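/- Let $n$ be a natural number and let $\mathcal{M}_n$ be the space of complex $n\times n$ matrices. For $1\le p\le\infty$ let $\|A\|_p$ denote the $p$-norm of $A\in\mathcal{M}_n$, i.e. the $\ell^p$ norm of the family $\sigma_1,\dots,\sigma_n$ of its singular values, listed with multiplicity: $\|A\|_p=\big(\sum_i\sigma_i^p\big)^{1/p}$ for $p<\infty$, and $\|A\|_\infty$ is the largest singular value. For a linear map $T:\mathcal{M}_n\to\mathcal{M}_n$ let $\|T\|_{p-p}=\sup_{A\ne 0}\|T(A)\|_p/\|A\|_p$, and call $T$ contractive for the $p$-norm if $\|T\|_{p-p}\le 1$. Suppose that the linear map $T:\mathcal{M}_n\to\mathcal{M}_n$ is positive (it maps positive semi-definite matrices to positive semi-definite matrices) and trace-preserving ($\operatorname{tr}T(A)=\operatorname{tr}A$ for all $A\in\mathcal{M}_n$). Then the following are equivalent (with $1/\infty=0$): (i) $\|T(\mathbb{1})\|_p\le n^{1/p}$ for some $1<p\le\infty$; (ii) $T$ is unital, i.e. $T(\mathbb{1})=\mathbb{1}$; (iii) $T$ is contractive for the $p$-norm for every $1\le p\le\infty$; (iv) $T$ is contractive for the $p$-norm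 for some $1<p\le\infty$. -/

import Mathlib

open scoped ENNReal ComplexOrder

noncomputable section

/-- The space `M_n` of complex `n × n` matrices. -/
abbrev Mat (n : ℕ) : Type := Matrix (Fin n) (Fin n) ℂ

/-- The `n` singular values of a complex `n × n` matrix, with multiplicity: those of the linear
operator that the matrix defines on the Euclidean space `ℂⁿ`. -/
def matSingularValues {n : ℕ} (A : Mat n) (i : Fin n) : ℝ :=
  (Matrix.toEuclideanLin A).singularValues i

/-- The `p`-norm of a matrix, the `ℓ^p` norm of its family of singular values: equal to
`(∑ i, σ i ^ p) ^ (1 / p)` for `1 ≤ p < ∞` and to the largest singular value for `p = ∞`. -/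
def schattenNorm {n : ℕ} (p : ℝ≥0∞) (A : Mat n) : ℝ :=
  ‖WithLp.toLp p (matSingularValues A)‖

/-- A positive linear map sends positive semi-definite matrices to positive semi-definite ones. -/
def IsPositiveMap {n r : ℕ} (T : Mat n →ₗ[ℂ] Mat r) : Prop :=
  ∀ A : Mat n, A.PosSemidef → (T A).PosSemidef

/-- A trace-preserving linear map. -/
def IsTracePreserving {n r : ℕ} (T : Mat n →ₗ[ℂ] Mat r) : Prop :=
  ∀ A : Mat n, (T A).trace = A.trace

/-- A unital linear map. -/
def IsUnital {n r : ℕ} (T : Mat n →ₗ[ℂ] Mat r) : Prop :=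
  T 1 = 1

/-- The operator norm `‖T‖_{p-p}`, the supremum of `‖T A‖_p / ‖A‖_p` over nonzero `A`, taken in
`[0, ∞]`. -/
def schattenOpNorm {n r : ℕ} (p : ℝ≥0∞) (T : Mat n →ₗ[ℂ] Mat r) : ℝ≥0∞ :=
  ⨆ (A : Mat n) (_ : A ≠ 0),
    ENNReal.ofReal (schattenNorm p (T A)) / ENNReal.ofReal (schattenNorm p A)

/-- `T` is contractive for the `p`-norm. -/
def IsContractive {n r : ℕ} (p : ℝ≥0∞) (T : Mat n →ₗ[ℂ] Mat r) : Prop :=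
  schattenOpNorm p T ≤ 1

end

open scoped Matrix

/-! Unital implies contractive: write `A = U diag(s) V` and `T A = U' diag(t) V'`, with `s`, `t` the
singular values. By linearity `t = m s`, where `m i j` is the `i`-th diagonal entry of `U'ᴴ T(U E_jj
V) V'ᴴ`. Russo–Dye for `T` bounds the row sums of `‖m i j‖` by 1; Russo–Dye for the trace dual,
which is unital because `T` preserves the trace, bounds the column sums. A doubly substochastic
matrix shrinks every `ℓ^p` norm (`schattenNorm_map_le`). Conversely, contractivity at `1` bounds `‖T
1‖_p` by `n^(1/p)`. Since `T 1` has trace `n`, its singular values sum to at least `n`, and strict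
convexity (`p < ∞`) or the bound `σ ≤ 1` (`p = ∞`) makes them all 1. A unitary of trace `n` is the
identity (`eq_one_of_trace_of_schattenNorm_le`). -/

/-- **Singular value decomposition** in matrix form. -/
theorem exists_unitary_mul_diagonal_mul {n : ℕ} (A : Mat n) :
    ∃ U ∈ Matrix.unitaryGroup (Fin n) ℂ, ∃ V ∈ Matrix.unitaryGroup (Fin n) ℂ,
      A = U * Matrix.diagonal (fun i => (matSingularValues A i : ℂ)) * V := by
  set L := Matrix.toEuclideanLin A with hL
  have hn : Module.finrank ℂ (EuclideanSpace ℂ (Fin n)) = n := by simp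
  set v := L.isSymmetric_adjoint_comp_self.eigenvectorBasis hn with hv
  have hvi : ∀ i, (LinearMap.adjoint L ∘ₗ L) (v i) = ((L.singularValues i : ℂ) ^ 2) • v i := by
    intro i
    rw [hv, LinearMap.IsSymmetric.apply_eigenvectorBasis, ← L.sq_singularValues_fin hn]
    norm_cast
  have hinner : ∀ i j, inner ℂ (L (v i)) (L (v j)) =
      if i = j then (L.singularValues i : ℂ) ^ 2 else 0 := by
    intro i j
    rw [← LinearMap.adjoint_inner_right, ← LinearMap.comp_apply, hvi, inner_smul_right,
      orthonormal_iff_ite.1 v.orthonormal]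
    by_cases h : i = j <;> simp [h]
  -- The left singular vectors are forced only where `σ i ≠ 0`; elsewhere `L (v i) = 0` and any
  -- orthonormal completion serves.
  have hort : Orthonormal ℂ ({i : Fin n | L.singularValues i ≠ 0}.domRestrict
      (fun i => ((L.singularValues i : ℂ)⁻¹) • L (v i))) := by
    rw [orthonormal_iff_ite]
    rintro ⟨i, hi⟩ ⟨j, hj⟩
    have hi' : (L.singularValues i : ℂ) ≠ 0 := by exact_mod_cast hi
    by_cases h : i = j
    · subst h
      simp only [Set.domRestrict, inner_smul_left, inner_smul_right, hinner, if_true, map_inv₀,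
        Complex.conj_ofReal]
      field_simp
    · simp [Set.domRestrict, inner_smul_left, inner_smul_right, hinner, h]
  obtain ⟨u, hu⟩ := hort.exists_orthonormalBasis_extension_of_card_eq (by simp)
  have hLv : ∀ i, L (v i) = (L.singularValues i : ℂ) • u i := by
    intro i
    by_cases h : L.singularValues i = 0
    · have := hinner i i
      rw [if_pos rfl, h] at this
      simpa [h] using this
    · rw [hu i h, smul_smul, mul_inv_cancel₀ (by exact_mod_cast h), one_smul]
  have key : ∀ b : OrthonormalBasis (Fin n) ℂ (EuclideanSpace ℂ (Fin n)),
      (Matrix.of fun i j => b j i) ∈ Matrix.unitaryGroup (Fin n) ℂ := by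
    intro b
    rw [Matrix.mem_unitaryGroup_iff']
    ext i j
    have := orthonormal_iff_ite.1 b.orthonormal i j
    rw [Matrix.one_apply, ← this, PiLp.inner_apply]
    simp [Matrix.mul_apply, Matrix.star_apply, mul_comm]
  refine ⟨_, key u, star (Matrix.of fun i j => v j i), Unitary.star_mem (key v), ?_⟩
  have h1 : A * (Matrix.of fun i j => v j i) = (Matrix.of fun i j => u j i) *
      Matrix.diagonal (fun i => (matSingularValues A i : ℂ)) := by
    ext i j
    have := congrArg (fun w : EuclideanSpace ℂ (Fin n) => w i) (hLv j)
    simp only [hL, Matrix.toLpLin_apply] at this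
    rw [Matrix.mul_diagonal, Matrix.mul_apply]
    simp only [Matrix.of_apply, matSingularValues]
    simpa [Matrix.mulVec, dotProduct, mul_comm] using this
  rw [← h1, mul_assoc, (Matrix.mem_unitaryGroup_iff.1 (key v)), mul_one]

open scoped Matrix.Norms.L2Operator in
/-- The **spectral theorem** for a unitary matrix, as a combination of orthogonal projections. -/
theorem Matrix.exists_sum_smul_posSemidef_of_mem_unitaryGroup {n : ℕ} {W : Mat n}
    (hW : W ∈ Matrix.unitaryGroup (Fin n) ℂ) :
    ∃ (s : Finset ℂ) (P : ℂ → Mat n), (∀ z ∈ s, ‖z‖ ≤ 1) ∧ (∀ z, (P z).PosSemidef) ∧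
      ∑ z ∈ s, P z = 1 ∧ ∑ z ∈ s, z • P z = W := by
  have hfin := Matrix.finite_spectrum W
  have hc : ∀ f : ℂ → ℂ, ContinuousOn f (spectrum ℂ W) := fun f => hfin.continuousOn f
  have hnormal : IsStarNormal W := ⟨by
    rw [commute_iff_eq, Unitary.star_mul_self_of_mem hW, Unitary.mul_star_self_of_mem hW]⟩
  -- Spectral projections: indicators of points are continuous on the finite spectrum.
  refine ⟨hfin.toFinset, fun z => cfc (fun x => if x = z then 1 else 0) W, ?_, ?_, ?_, ?_⟩
  · intro z hz
    exact (spectrum.norm_eq_one_of_unitary hW (hfin.mem_toFinset.1 hz)).le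
  · intro z
    have : cfc (fun x : ℂ => if x = z then (1 : ℂ) else 0) W =
        (cfc (fun x : ℂ => if x = z then (1 : ℂ) else 0) W)ᴴ *
          cfc (fun x : ℂ => if x = z then (1 : ℂ) else 0) W := by
      rw [← Matrix.star_eq_conjTranspose, ← cfc_star, ← cfc_mul _ _ W (hc _) (hc _)]
      congr 1
      ext x
      by_cases h : x = z <;> simp [h]
    dsimp only
    rw [this]
    exact Matrix.posSemidef_conjTranspose_mul_self _
  · rw [← cfc_sum _ _ _ (fun _ _ => hc _), ← cfc_one ℂ W]
    refine cfc_congr fun x hx => ?_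
    have hx' : x ∈ hfin.toFinset := hfin.mem_toFinset.2 hx
    simpa [Finset.sum_apply] using hx
  · simp_rw [← cfc_const_mul _ _ W (hc _)]
    rw [← cfc_sum _ _ _ (fun _ _ => hc _)]
    conv_rhs => rw [← cfc_id ℂ W]
    refine cfc_congr fun x hx => ?_
    simp only [Finset.sum_apply, mul_ite, mul_one, mul_zero, Finset.sum_ite_eq,
      hfin.mem_toFinset.2 hx, if_true, id]

/-- Weighted arithmetic–geometric form of Cauchy–Schwarz for a positive semidefinite matrix. -/
theorem Matrix.PosSemidef.norm_mul_mul_apply_le {n : ℕ} {P : Mat n} (hP : P.PosSemidef)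
    (X Y : Mat n) (i : Fin n) :
    ‖(X * P * Y) i i‖ ≤ (((X * P * Xᴴ) i i).re + ((Yᴴ * P * Y) i i).re) / 2 := by
  obtain ⟨B, rfl⟩ : ∃ B : Mat n, P = Bᴴ * B := by
    open scoped Matrix.Norms.L2Operator MatrixOrder in
    exact CStarAlgebra.nonneg_iff_eq_star_mul_self.1 hP.nonneg
  have h1 : ((X * (Bᴴ * B) * Xᴴ) i i).re = ∑ m, ‖(X * Bᴴ) i m‖ ^ 2 := by
    have : X * (Bᴴ * B) * Xᴴ = (X * Bᴴ) * (X * Bᴴ)ᴴ := by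
      simp [Matrix.conjTranspose_mul, mul_assoc]
    rw [this, Matrix.mul_apply, Complex.re_sum]
    refine Finset.sum_congr rfl fun m _ => ?_
    rw [Matrix.conjTranspose_apply, Complex.star_def, Complex.mul_conj']
    norm_cast
  have h2 : ((Yᴴ * (Bᴴ * B) * Y) i i).re = ∑ m, ‖(B * Y) m i‖ ^ 2 := by
    have : Yᴴ * (Bᴴ * B) * Y = (B * Y)ᴴ * (B * Y) := by
      simp [Matrix.conjTranspose_mul, mul_assoc]
    rw [this, Matrix.mul_apply, Complex.re_sum]
    refine Finset.sum_congr rfl fun m _ => ?_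
    rw [Matrix.conjTranspose_apply, Complex.star_def, Complex.conj_mul']
    norm_cast
  have h3 : X * (Bᴴ * B) * Y = (X * Bᴴ) * (B * Y) := by simp [mul_assoc]
  rw [h1, h2, h3, Matrix.mul_apply, ← Finset.sum_add_distrib, Finset.sum_div]
  refine (norm_sum_le _ _).trans (Finset.sum_le_sum fun m _ => ?_)
  rw [norm_mul]
  nlinarith [sq_nonneg (‖(X * Bᴴ) i m‖ - ‖(B * Y) m i‖)]

/-- **Russo–Dye**, entrywise: a positive unital map sends unitaries to contractions. -/
theorem IsPositiveMap.norm_mul_map_mul_apply_le_one {n : ℕ} {T : Mat n →ₗ[ℂ] Mat n}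
    (hpos : IsPositiveMap T) (hT : IsUnital T) {W X Y : Mat n}
    (hW : W ∈ Matrix.unitaryGroup (Fin n) ℂ) (hX : X ∈ Matrix.unitaryGroup (Fin n) ℂ)
    (hY : Y ∈ Matrix.unitaryGroup (Fin n) ℂ) (i : Fin n) :
    ‖(X * T W * Y) i i‖ ≤ 1 := by
  obtain ⟨s, P, hs, hP, hP1, rfl⟩ := Matrix.exists_sum_smul_posSemidef_of_mem_unitaryGroup hW
  have hsum : ∀ X Y : Mat n, ∑ z ∈ s, X * T (P z) * Y = X * Y := by
    intro X Y
    rw [← Finset.sum_mul, ← Finset.mul_sum, ← map_sum, hP1, hT, mul_one]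
  have hre : ∀ X Y : Mat n, X * Y = 1 → ∑ z ∈ s, ((X * T (P z) * Y) i i).re = 1 := by
    intro X Y hXY
    rw [← Complex.re_sum, ← Matrix.sum_apply, hsum, hXY]
    simp
  have hexp : (X * T (∑ z ∈ s, z • P z) * Y) i i = ∑ z ∈ s, z * (X * T (P z) * Y) i i := by
    simp [Finset.mul_sum, Finset.sum_mul, Matrix.sum_apply]
  rw [hexp]
  calc ‖∑ z ∈ s, z * (X * T (P z) * Y) i i‖
      ≤ ∑ z ∈ s, (((X * T (P z) * Xᴴ) i i).re + ((Yᴴ * T (P z) * Y) i i).re) / 2 := by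
        refine (norm_sum_le _ _).trans (Finset.sum_le_sum fun z hz => ?_)
        rw [norm_mul]
        exact (mul_le_of_le_one_left (norm_nonneg _) (hs z hz)).trans
          ((hpos _ (hP z)).norm_mul_mul_apply_le X Y i)
    _ = 1 := by
        rw [← Finset.sum_div, Finset.sum_add_distrib,
          hre X Xᴴ (Matrix.mem_unitaryGroup_iff.1 hX),
          hre Yᴴ Y (Matrix.mem_unitaryGroup_iff'.1 hY)]
        norm_num

/-! ### Duality for the trace pairing -/

/-- The adjoint of a linear map of matrices for the trace pairing. -/
noncomputable def traceDual {n : ℕ} (T : Mat n →ₗ[ℂ] Mat n) : Mat n →ₗ[ℂ] Mat n where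
  toFun W := Matrix.of fun a b => (W * T (Matrix.single b a 1)).trace
  map_add' W W' := by
    ext a b
    simp [add_mul]
  map_smul' c W := by
    ext a b
    simp

theorem trace_traceDual_mul {n : ℕ} (T : Mat n →ₗ[ℂ] Mat n) (W B : Mat n) :
    (traceDual T W * B).trace = (W * T B).trace := by
  conv_rhs => rw [Matrix.matrix_eq_sum_single B]
  simp only [map_sum, Finset.mul_sum, Matrix.trace_sum]
  rw [Finset.sum_comm]
  simp only [Matrix.trace, Matrix.diag_apply, Matrix.mul_apply (M := traceDual T W)]
  refine Finset.sum_congr rfl fun a _ => Finset.sum_congr rfl fun b _ => ?_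
  have : Matrix.single b a (B b a) = B b a • Matrix.single b a (1 : ℂ) := by
    simp [Matrix.smul_single]
  rw [this, map_smul, Matrix.mul_smul]
  simp [traceDual, Matrix.trace, Finset.mul_sum, mul_comm]

theorem IsTracePreserving.isUnital_traceDual {n : ℕ} {T : Mat n →ₗ[ℂ] Mat n}
    (htr : IsTracePreserving T) : IsUnital (traceDual T) := by
  ext a b
  by_cases h : a = b
  · subst h
    simp [traceDual, htr _]
  · simp [traceDual, htr _, h, Matrix.trace_single_eq_of_ne b a (1 : ℂ) (Ne.symm h)]

/-- The quadratic form of the dual at `x` is `tr (W T(x xᴴ))`, a trace pairing of two positive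
semidefinite matrices. -/
theorem IsPositiveMap.traceDual {n : ℕ} {T : Mat n →ₗ[ℂ] Mat n}
    (hpos : IsPositiveMap T) : IsPositiveMap (traceDual T) := by
  intro W hW
  obtain ⟨B, rfl⟩ : ∃ B : Mat n, W = Bᴴ * B := by
    open scoped Matrix.Norms.L2Operator MatrixOrder in
    exact CStarAlgebra.nonneg_iff_eq_star_mul_self.1 hW.nonneg
  have hquad : ∀ x : Fin n → ℂ, 0 ≤ star x ⬝ᵥ (_root_.traceDual T (Bᴴ * B) *ᵥ x) := by
    intro x
    have h1 : star x ⬝ᵥ (_root_.traceDual T (Bᴴ * B) *ᵥ x) =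
        (_root_.traceDual T (Bᴴ * B) * Matrix.vecMulVec x (star x)).trace := by
      rw [Matrix.mul_vecMulVec, Matrix.trace_vecMulVec, dotProduct_comm]
    rw [h1, trace_traceDual_mul, mul_assoc, Matrix.trace_mul_comm]
    exact ((hpos _ (Matrix.posSemidef_vecMulVec_self_star x)).mul_mul_conjTranspose_same
      B).trace_nonneg
  rw [← Matrix.isPositive_toEuclideanLin_iff, LinearMap.isPositive_iff_complex]
  intro x
  have h : 0 ≤ inner ℂ (Matrix.toEuclideanLin (_root_.traceDual T (Bᴴ * B)) x) x := by
    rw [← inner_conj_symm, starRingEnd_apply, star_nonneg_iff]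
    simpa [EuclideanSpace.inner_eq_star_dotProduct, dotProduct_comm] using hquad x.ofLp
  have h' := Complex.nonneg_iff.1 h
  exact ⟨Complex.ext (by simp) (by simpa using h'.2), h'.1⟩

/-! ### Contractivity of positive unital trace-preserving maps -/

/-- A doubly substochastic matrix does not increase `ℓ^p` norms of nonnegative vectors. -/
theorem norm_toLp_le_of_doublySubstochastic {ι : Type*} [Fintype ι] {p : ℝ≥0∞} (hp : 1 ≤ p)
    {M : ι → ι → ℝ} (hM : ∀ i j, 0 ≤ M i j) (hrow : ∀ i, ∑ j, M i j ≤ 1)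
    (hcol : ∀ j, ∑ i, M i j ≤ 1) {s t : ι → ℝ} (hs : ∀ i, 0 ≤ s i) (ht : ∀ i, 0 ≤ t i)
    (hts : ∀ i, t i ≤ ∑ j, M i j * s j) :
    ‖WithLp.toLp p t‖ ≤ ‖WithLp.toLp p s‖ := by
  rcases eq_or_ne p ∞ with rfl | hp'
  · rw [PiLp.norm_eq_ciSup, PiLp.norm_eq_ciSup]
    have hb : ∀ j, s j ≤ ⨆ i, ‖s i‖ := fun j =>
      (le_abs_self _).trans (le_ciSup (f := fun i => ‖s i‖) (Set.finite_range _).bddAbove j)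
    have h0 : 0 ≤ ⨆ i, ‖s i‖ := Real.iSup_nonneg fun _ => norm_nonneg _
    refine Real.iSup_le (fun i => ?_) h0
    rw [Real.norm_of_nonneg (ht i)]
    calc t i ≤ ∑ j, M i j * s j := hts i
      _ ≤ ∑ j, M i j * ⨆ i, ‖s i‖ :=
        Finset.sum_le_sum fun j _ => mul_le_mul_of_nonneg_left (hb j) (hM i j)
      _ = (∑ j, M i j) * ⨆ i, ‖s i‖ := by rw [Finset.sum_mul]
      _ ≤ ⨆ i, ‖s i‖ := mul_le_of_le_one_left h0 (hrow i)
  · have hr : 1 ≤ p.toReal := by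
      simpa using (ENNReal.toReal_le_toReal ENNReal.one_ne_top hp').2 hp
    have hr0 : 0 < p.toReal := zero_lt_one.trans_le hr
    rw [PiLp.norm_eq_sum hr0, PiLp.norm_eq_sum hr0]
    simp only [Real.norm_of_nonneg (ht _), Real.norm_of_nonneg (hs _)]
    have hMs : ∀ i, 0 ≤ ∑ j, M i j * s j ^ p.toReal := fun i =>
      Finset.sum_nonneg fun j _ => mul_nonneg (hM i j) (Real.rpow_nonneg (hs j) _)
    -- Jensen in weighted Hölder form; the total weight of a row enters to the power `1 - 1/p ≥ 0`,
    -- so it is at most 1.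
    have hJ : ∀ i, t i ^ p.toReal ≤ ∑ j, M i j * s j ^ p.toReal := by
      intro i
      have h1 : t i ≤ (∑ j, M i j * s j ^ p.toReal) ^ p.toReal⁻¹ :=
        ((hts i).trans (Real.inner_le_weight_mul_Lp_of_nonneg _ hr _ _ (hM i) hs)).trans
          (mul_le_of_le_one_left (Real.rpow_nonneg (hMs i) _)
            (Real.rpow_le_one (Finset.sum_nonneg fun j _ => hM i j) (hrow i)
              (sub_nonneg.2 (inv_le_one_of_one_le₀ hr))))
      exact (Real.le_rpow_inv_iff_of_pos (ht i) (hMs i) hr0).1 h1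
    refine Real.rpow_le_rpow (Finset.sum_nonneg fun i _ => Real.rpow_nonneg (ht i) _) ?_
      (by positivity)
    calc ∑ i, t i ^ p.toReal ≤ ∑ i, ∑ j, M i j * s j ^ p.toReal :=
          Finset.sum_le_sum fun i _ => hJ i
      _ = ∑ j, (∑ i, M i j) * s j ^ p.toReal := by
          rw [Finset.sum_comm]
          simp only [Finset.sum_mul]
      _ ≤ ∑ j, s j ^ p.toReal := Finset.sum_le_sum fun j _ =>
          mul_le_of_le_one_left (Real.rpow_nonneg (hs j) _) (hcol j)

theorem matSingularValues_nonneg {n : ℕ} (A : Mat n) (i : Fin n) : 0 ≤ matSingularValues A i :=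
  LinearMap.singularValues_nonneg _ _

theorem Complex.exists_norm_eq_one_mul_eq_norm (z : ℂ) : ∃ c : ℂ, ‖c‖ = 1 ∧ c * z = ‖z‖ := by
  by_cases h : z = 0
  · exact ⟨1, by simp, by simp [h]⟩
  · have h' : (‖z‖ : ℂ) ≠ 0 := by simpa using h
    refine ⟨(starRingEnd ℂ) z / ‖z‖, by simp [h], ?_⟩
    rw [div_mul_eq_mul_div, Complex.conj_mul', sq, mul_div_assoc, div_self h', mul_one]

theorem Matrix.diagonal_mem_unitaryGroup {n : ℕ} {c : Fin n → ℂ} (hc : ∀ i, ‖c i‖ = 1) :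
    Matrix.diagonal c ∈ Matrix.unitaryGroup (Fin n) ℂ := by
  rw [Matrix.mem_unitaryGroup_iff, Matrix.star_eq_conjTranspose, Matrix.diagonal_conjTranspose,
    Matrix.diagonal_mul_diagonal, ← Matrix.diagonal_one]
  congr 1
  ext i
  simp [Complex.mul_conj', hc i]

theorem Matrix.diagonal_eq_sum_smul_single {n : ℕ} (c : Fin n → ℂ) :
    Matrix.diagonal c = ∑ j, c j • (Matrix.single j j 1 : Mat n) := by
  ext a b
  simp [Matrix.sum_apply, Matrix.diagonal_apply, Matrix.single_apply, ite_and]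

theorem schattenNorm_map_le {n : ℕ} {T : Mat n →ₗ[ℂ] Mat n} (hpos : IsPositiveMap T)
    (htr : IsTracePreserving T) (hT : IsUnital T) {p : ℝ≥0∞} (hp : 1 ≤ p) (A : Mat n) :
    schattenNorm p (T A) ≤ schattenNorm p A := by
  obtain ⟨U, hU, V, hV, hA⟩ := exists_unitary_mul_diagonal_mul A
  obtain ⟨U', hU', V', hV', hTA⟩ := exists_unitary_mul_diagonal_mul (T A)
  set m : Fin n → Fin n → ℂ := fun i j =>
    (star U' * T (U * Matrix.single j j 1 * V) * star V') i i with hm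
  have hcomb : ∀ (c : Fin n → ℂ) i,
      (star U' * T (U * Matrix.diagonal c * V) * star V') i i = ∑ j, c j * m i j := by
    intro c i
    simp only [hm, Matrix.diagonal_eq_sum_smul_single c, Finset.mul_sum, Finset.sum_mul,
      Matrix.sum_apply, map_sum, Matrix.mul_smul, Matrix.smul_mul, map_smul, Matrix.smul_apply,
      smul_eq_mul]
  refine norm_toLp_le_of_doublySubstochastic hp (M := fun i j => ‖m i j‖)
    (fun _ _ => norm_nonneg _) (fun i => ?_) (fun j => ?_) (matSingularValues_nonneg A)
    (matSingularValues_nonneg (T A)) (fun i => ?_)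
  -- Phases `c j` turn the row sum of norms into one diagonal entry of the image of the unitary `U
  -- diag(c) V`.
  · choose c hc hcm using fun j => Complex.exists_norm_eq_one_mul_eq_norm (m i j)
    have := hpos.norm_mul_map_mul_apply_le_one hT
      (mul_mem (mul_mem hU (Matrix.diagonal_mem_unitaryGroup hc)) hV)
      (Unitary.star_mem hU') (Unitary.star_mem hV') i
    rw [hcomb] at this
    simp only [hcm] at this
    rw [← Complex.ofReal_sum, Complex.norm_real] at this
    exact (le_abs_self _).trans this
  -- Here the phases run over the rows; moving `T` across the trace turns the column sum into an
  -- entry of the dual map at a unitary.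
  · choose c hc hcm using fun i => Complex.exists_norm_eq_one_mul_eq_norm (m i j)
    have h1 := hpos.traceDual.norm_mul_map_mul_apply_le_one htr.isUnital_traceDual
      (mul_mem (mul_mem (Unitary.star_mem hV') (Matrix.diagonal_mem_unitaryGroup hc))
        (Unitary.star_mem hU')) hV hU j
    have h2 : ∑ i, c i * m i j =
        (V * traceDual T (star V' * Matrix.diagonal c * star U') * U) j j := by
      calc ∑ i, c i * m i j = (Matrix.diagonal c *
            (star U' * T (U * Matrix.single j j 1 * V) * star V')).trace := by
            simp [Matrix.trace, Matrix.diagonal_mul, hm]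
        _ = (star V' * Matrix.diagonal c * star U' *
              T (U * Matrix.single j j 1 * V)).trace := by
            rw [← mul_assoc, Matrix.trace_mul_comm]
            simp only [mul_assoc]
        _ = (V * traceDual T (star V' * Matrix.diagonal c * star U') * U *
              Matrix.single j j 1).trace := by
            rw [← trace_traceDual_mul, ← mul_assoc, Matrix.trace_mul_comm]
            simp only [mul_assoc]
        _ = _ := by simp [Matrix.trace_mul_single]
    rw [← h2] at h1
    simp only [hcm] at h1
    rw [← Complex.ofReal_sum, Complex.norm_real] at h1
    exact (le_abs_self _).trans h1
  · have h1 : (matSingularValues (T A) i : ℂ) = ∑ j, (matSingularValues A j : ℂ) * m i j := by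
      rw [← hcomb, ← hA]
      conv_rhs => rw [hTA]
      have : star U' * (U' * Matrix.diagonal (fun i => (matSingularValues (T A) i : ℂ)) * V') *
          star V' = (star U' * U') * Matrix.diagonal (fun i => (matSingularValues (T A) i : ℂ)) *
          (V' * star V') := by simp only [mul_assoc]
      rw [this, Matrix.mem_unitaryGroup_iff'.1 hU', Matrix.mem_unitaryGroup_iff.1 hV']
      simp
    calc matSingularValues (T A) i = ‖(matSingularValues (T A) i : ℂ)‖ := by
          rw [Complex.norm_real, Real.norm_of_nonneg (matSingularValues_nonneg _ _)]
      _ ≤ ∑ j, ‖m i j‖ * matSingularValues A j := by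
          rw [h1]
          refine (norm_sum_le _ _).trans (Finset.sum_le_sum fun j _ => ?_)
          rw [norm_mul, Complex.norm_real, Real.norm_of_nonneg (matSingularValues_nonneg _ _),
            mul_comm]

/-! ### Extremality of the identity -/

theorem matSingularValues_one {n : ℕ} (i : Fin n) : matSingularValues (1 : Mat n) i = 1 := by
  obtain ⟨U, hU, V, hV, h⟩ := exists_unitary_mul_diagonal_mul (1 : Mat n)
  set D : Mat n := Matrix.diagonal (fun i => (matSingularValues (1 : Mat n) i : ℂ)) with hD
  have h1 : D = star U * star V := by
    calc D = (star U * U) * D * (V * star V) := by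
          rw [Matrix.mem_unitaryGroup_iff'.1 hU, Matrix.mem_unitaryGroup_iff.1 hV, one_mul, mul_one]
      _ = star U * (U * D * V) * star V := by simp only [mul_assoc]
      _ = _ := by rw [← h, mul_one]
  have h2 : D * star D = 1 := Matrix.mem_unitaryGroup_iff.1
    (h1 ▸ mul_mem (Unitary.star_mem hU) (Unitary.star_mem hV))
  have h3 := congrFun (congrFun h2 i) i
  rw [hD, Matrix.star_eq_conjTranspose, Matrix.diagonal_conjTranspose,
    Matrix.diagonal_mul_diagonal] at h3
  simp only [Matrix.diagonal_apply_eq, Matrix.one_apply_eq, Pi.star_apply, Complex.star_def,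
    Complex.conj_ofReal] at h3
  have h4 : matSingularValues (1 : Mat n) i * matSingularValues (1 : Mat n) i = 1 := by
    exact_mod_cast h3
  nlinarith [matSingularValues_nonneg (1 : Mat n) i]

/-- Equality fails for `n = 0`, `p = ∞`, where the sides are `0` and `0 ^ 0 = 1`. -/
theorem schattenNorm_one_le {n : ℕ} {p : ℝ≥0∞} (hp : 1 ≤ p) :
    schattenNorm p (1 : Mat n) ≤ (n : ℝ) ^ (p⁻¹).toReal := by
  unfold schattenNorm
  rcases eq_or_ne p ∞ with rfl | hp'
  · rw [PiLp.norm_eq_ciSup]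
    refine Real.iSup_le (fun i => ?_) (by positivity)
    simp [matSingularValues_one]
  · rw [PiLp.norm_eq_sum (ENNReal.toReal_pos (zero_lt_one.trans_le hp).ne' hp')]
    simp [matSingularValues_one, ENNReal.toReal_inv]

/-- A matrix of trace `n` whose Schatten norm is at most that of the identity is the identity. -/
theorem eq_one_of_trace_of_schattenNorm_le {n : ℕ} {p : ℝ≥0∞} (hp : 1 < p) {B : Mat n}
    (htr : B.trace = n) (hB : schattenNorm p B ≤ (n : ℝ) ^ (p⁻¹).toReal) : B = 1 := by
  obtain ⟨U, hU, V, hV, h⟩ := exists_unitary_mul_diagonal_mul B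
  set σ := matSingularValues B with hσ
  have hσ0 : ∀ i, 0 ≤ σ i := matSingularValues_nonneg B
  have hsum : ∑ _i : Fin n, (1 : ℝ) ≤ ∑ i, σ i := by
    have h1 : (n : ℂ) = ∑ i, σ i * (V * U) i i := by
      rw [← htr, h, Matrix.trace_mul_comm, ← mul_assoc, Matrix.trace]
      simp [Matrix.mul_diagonal, mul_comm]
    calc ∑ _i : Fin n, (1 : ℝ) = ‖(n : ℂ)‖ := by simp
      _ ≤ ∑ i, σ i := by
        rw [h1]
        refine (norm_sum_le _ _).trans (Finset.sum_le_sum fun i _ => ?_)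
        rw [norm_mul, Complex.norm_real, Real.norm_of_nonneg (hσ0 i)]
        exact mul_le_of_le_one_right (hσ0 i) (entry_norm_bound_of_unitary (mul_mem hV hU) i i)
  have hσ1 : ∀ i, σ i = 1 := by
    unfold schattenNorm at hB
    rcases eq_or_ne p ∞ with rfl | hp'
    · rw [PiLp.norm_eq_ciSup] at hB
      have hle : ∀ i, σ i ≤ 1 := by
        intro i
        have := (le_ciSup (f := fun i => ‖σ i‖) (Set.finite_range _).bddAbove i).trans hB
        simpa using (le_abs_self _).trans this
      have heq := (Finset.sum_eq_sum_iff_of_le fun i _ => hle i).1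
        (le_antisymm (Finset.sum_le_sum fun i _ => hle i) hsum)
      exact fun i => heq i (Finset.mem_univ i)
    · have hr : 1 < p.toReal := by
        simpa using (ENNReal.toReal_lt_toReal ENNReal.one_ne_top hp').2 hp
      have hr0 : 0 < p.toReal := zero_lt_one.trans hr
      rw [PiLp.norm_eq_sum hr0, ENNReal.toReal_inv, one_div,
        Real.rpow_le_rpow_iff (Finset.sum_nonneg fun i _ => Real.rpow_nonneg (norm_nonneg _) _)
          (Nat.cast_nonneg n) (inv_pos.2 hr0)] at hB
      simp only [← hσ, Real.norm_of_nonneg (hσ0 _)] at hB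
      -- Bernoulli, the tangent line of `x ^ p` at 1. Summed, the left sides give at least `n` and
      -- the right sides at most `n`, so equality holds termwise; as `p > 1`, this forces `σ i = 1`.
      have hbern : ∀ i, 1 + p.toReal * (σ i - 1) ≤ σ i ^ p.toReal := fun i => by
        simpa using one_add_mul_self_le_rpow_one_add (s := σ i - 1)
          (by linarith [hσ0 i]) hr.le
      have htot : ∑ i, σ i ^ p.toReal ≤ ∑ i, (1 + p.toReal * (σ i - 1)) := by
        rw [Finset.sum_add_distrib, ← Finset.mul_sum, Finset.sum_sub_distrib]
        have : (n : ℝ) = ∑ _i : Fin n, (1 : ℝ) := by simp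
        rw [this] at hB
        nlinarith
      have heq := (Finset.sum_eq_sum_iff_of_le fun i _ => hbern i).1
        (le_antisymm (Finset.sum_le_sum fun i _ => hbern i) htot)
      intro i
      by_contra hne
      have := one_add_mul_self_lt_rpow_one_add (s := σ i - 1) (by linarith [hσ0 i])
        (sub_ne_zero.2 hne) hr
      rw [add_sub_cancel] at this
      exact this.ne (heq i (Finset.mem_univ i))
  have hBU : B = U * V := by
    rw [h]
    simp [hσ1]
  have hBB : Bᴴ * B = 1 := by
    rw [hBU]
    exact Matrix.mem_unitaryGroup_iff'.1 (mul_mem hU hV)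
  -- As `B` is unitary of trace `n`, the trace of `(B - 1)ᴴ (B - 1)` is `n - n - n + n = 0`.
  rw [← sub_eq_zero, ← Matrix.trace_conjTranspose_mul_self_eq_zero_iff]
  have : (B - 1)ᴴ * (B - 1) = 1 - Bᴴ - B + 1 := by
    rw [Matrix.conjTranspose_sub, Matrix.conjTranspose_one, sub_mul, mul_sub, hBB]
    noncomm_ring
  rw [this]
  simp [Matrix.trace_conjTranspose, htr]

theorem theorem3 (n : ℕ) (T : Mat n →ₗ[ℂ] Mat n)
    (hpos : IsPositiveMap T) (htr : IsTracePreserving T) :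
    List.TFAE [
      ∃ p : ℝ≥0∞, 1 < p ∧ schattenNorm p (T 1) ≤ (n : ℝ) ^ (p⁻¹).toReal,
      IsUnital T,
      ∀ p : ℝ≥0∞, 1 ≤ p → IsContractive p T,
      ∃ p : ℝ≥0∞, 1 < p ∧ IsContractive p T] := by
  tfae_have 1 → 2 := by
    rintro ⟨p, hp, h⟩
    exact eq_one_of_trace_of_schattenNorm_le hp (by rw [htr]; simp) h
  tfae_have 2 → 3 := by
    intro hT p hp
    refine iSup₂_le fun A _ => ENNReal.div_le_of_le_mul ?_
    rw [one_mul]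
    exact ENNReal.ofReal_le_ofReal (schattenNorm_map_le hpos htr hT hp A)
  tfae_have 3 → 4 := fun h => ⟨∞, ENNReal.one_lt_top, h ∞ le_top⟩
  tfae_have 4 → 1 := by
    rintro ⟨p, hp, h⟩
    refine ⟨p, hp, le_trans ?_ (schattenNorm_one_le hp.le)⟩
    -- For `n = 0` the supremum is over the empty set and says nothing, but all matrices coincide.
    rcases Nat.eq_zero_or_pos n with rfl | hn
    · rw [Subsingleton.elim (T 1) 1]
    · have : Nonempty (Fin n) := ⟨⟨0, hn⟩⟩
      have h1 : ENNReal.ofReal (schattenNorm p (T 1)) / ENNReal.ofReal (schattenNorm p 1) ≤ 1 :=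
        (le_iSup₂ (f := fun (A : Mat n) (_ : A ≠ 0) => ENNReal.ofReal (schattenNorm p (T A)) /
          ENNReal.ofReal (schattenNorm p A)) 1 one_ne_zero).trans h
      have hpos1 : 0 < schattenNorm p (1 : Mat n) := by
        have : Fact (1 ≤ p) := ⟨hp.le⟩
        refine norm_pos_iff.2 fun h0 => ?_
        have := congrArg (fun w : PiLp p (fun _ : Fin n => ℝ) => w ⟨0, hn⟩) h0
        simp [matSingularValues_one] at this
      rw [ENNReal.div_le_iff (by simpa using hpos1) ENNReal.ofReal_ne_top, one_mul] at h1
      exact (ENNReal.ofReal_le_ofReal_iff hpos1.le).1 h1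
  tfae_finish
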